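/- Let $X$ be a finite data set and let $k \ge 2$. A $k$-clustering of $X$ is a partition $\mathcal{C} = (C_1, \dots, C_k)$ of $X$ into $k$ labelled, possibly empty clusters. For two $k$-clusterings $\mathcal{C}, \mathcal{C}'$ of $X$, the clustering-difference graph $CDG(\mathcal{C}, \mathcal{C}')$ is the directed arc-labelled multigraph with vertices $c_1, \dots, c_k$ that has an edge $(c_i, c_j)$ with label $x$ if and only if $i \ne j$, $x \in C_i$ and $x \in C'_j$. A clustering $\mathcal{C}'$ arises from $\mathcal{C}$ by a cyclical move (respectively, a sequential move) if the edges of $CDG(\mathcal{C}, \mathcal{C}')$ form a single directed cycle (respectively, a single directed path with at least one edge), where the vertices of a cycle or path are pairwise distinct. The transformation distance $d(\mathcal{C}, \mathcal{C}')$ is the minimum number of cyclical and sequential moves needed to transform $\mathcal{C}$ into $\mathcal{C}'$. The shared degree $\eta_i$ of $c_i$ is the minimum of the indegree and the outdegree of $c_i$ in $CDG(\mathcal{C}, \mathcal{C}')$, and $\delta_i = \bigl|\, |C_i| - |C'_i| \,\bigr|$. **Theorem.** Let $\mathcal{C}, \mathcal{C}'$ be $k$-clusterings of the same data set $X$. Let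 $i_1$ be an index that maximizes $\eta_i$ over all $i \in \{1, \dots, k\}$, and let $i_2 \ne i_1$ be an index that maximizes $\eta_i$ over all $i \ne i_1$. Then $$d(\mathcal{C}, \mathcal{C}') \le \eta_{i_1} + \max\Bigl\{ \eta_{i_2},\ \frac{1}{2} \sum_{i=1}^k \delta_i \Bigr\}.$$ -/

import Mathlib

/-- A `k`-clustering of the data set `X`: every item is assigned to exactly one of `k` labelled
clusters. Clusters may be empty. -/
abbrev KClustering (X : Type*) (k : ℕ) : Type _ := X → Fin k

/-- The `i`-th cluster `C_i`, as a set of items. -/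
def cluster {X : Type*} [Fintype X] {k : ℕ} (C : KClustering X k) (i : Fin k) : Finset X :=
  Finset.univ.filter fun x => C x = i

/-- An arc of a directed arc-labelled multigraph with vertices `c_1, …, c_k` and labels in `X`. -/
@[ext]
structure Arc (X : Type*) (k : ℕ) where
  tail : Fin k
  head : Fin k
  label : X

/-- The edge set of the clustering-difference graph from `C` to `C'`: there is an edge from `c_i` to
`c_j` with label `x` if and only if `x ∈ C_i`, `x ∈ C'_j` and `i ≠ j`. -/
def CDG {X : Type*} [Fintype X] {k : ℕ} (C C' : KClustering X k) : Set (Arc X k) :=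
  {a | a.tail ≠ a.head ∧ a.label ∈ cluster C a.tail ∧ a.label ∈ cluster C' a.head}

/-- The number of edges in `E` that leave the vertex `i`. -/
noncomputable def outDegree {X : Type*} {k : ℕ} (E : Set (Arc X k)) (i : Fin k) : ℕ :=
  {a ∈ E | a.tail = i}.ncard

/-- The number of edges in `E` that enter the vertex `i`. -/
noncomputable def inDegree {X : Type*} {k : ℕ} (E : Set (Arc X k)) (i : Fin k) : ℕ :=
  {a ∈ E | a.head = i}.ncard

/-- The shared degree of a vertex: the minimum of its indegree and its outdegree. -/
noncomputable def sharedDegree {X : Type*} {k : ℕ} (E : Set (Arc X k)) (i : Fin k) : ℕ :=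
  min (inDegree E i) (outDegree E i)

/-- The edge set `E` is a single directed path with `m + 1 ≥ 1` edges through the pairwise distinct
vertices `w 0, …, w (m + 1)`. -/
def IsDirectedPath {X : Type*} {k : ℕ} (E : Set (Arc X k)) : Prop :=
  ∃ (m : ℕ) (w : Fin (m + 2) → Fin k) (x : Fin (m + 1) → X), Function.Injective w ∧
    E = Set.range fun s : Fin (m + 1) => Arc.mk (w s.castSucc) (w s.succ) (x s)

/-- The edge set `E` is a single directed cycle with `m + 2 ≥ 2` edges through the pairwise distinct
vertices `w 0, …, w (m + 1)`; the addition `s + 1` in `Fin (m + 2)` is cyclic. -/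
def IsDirectedCycle {X : Type*} {k : ℕ} (E : Set (Arc X k)) : Prop :=
  ∃ (m : ℕ) (w : Fin (m + 2) → Fin k) (x : Fin (m + 2) → X), Function.Injective w ∧
    E = Set.range fun s : Fin (m + 2) => Arc.mk (w s) (w (s + 1)) (x s)

/-- `C'` arises from `C` by one cyclical move. -/
def IsCyclicalMove {X : Type*} [Fintype X] {k : ℕ} (C C' : KClustering X k) : Prop :=
  IsDirectedCycle (CDG C C')

/-- `C'` arises from `C` by one sequential move. -/
def IsSequentialMove {X : Type*} [Fintype X] {k : ℕ} (C C' : KClustering X k) : Prop :=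
  IsDirectedPath (CDG C C')

/-- `C` can be transformed into `C'` by a sequence of exactly `m` moves, each of which is cyclical or
sequential. -/
def TransformsIn {X : Type*} [Fintype X] {k : ℕ} (C C' : KClustering X k) (m : ℕ) : Prop :=
  ∃ D : ℕ → KClustering X k, D 0 = C ∧ D m = C' ∧
    ∀ s < m, IsCyclicalMove (D s) (D (s + 1)) ∨ IsSequentialMove (D s) (D (s + 1))

/-- The transformation distance `d(C, C')`: the minimum number of cyclical and sequential moves
needed to transform `C` into `C'`. The minimum is attained, see `transformsIn_transformationDistance`.
-/
noncomputable def transformationDistance {X : Type*} [Fintype X] {k : ℕ}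
    (C C' : KClustering X k) : ℕ :=
  sInf {m | TransformsIn C C' m}

/-- The change `δ_i = | |C_i| - |C'_i| |` in the size of the `i`-th cluster. -/
def sizeChange {X : Type*} [Fintype X] {k : ℕ} (C C' : KClustering X k) (i : Fin k) : ℤ :=
  |((cluster C i).card : ℤ) - ((cluster C' i).card : ℤ)|

/-- Moving a single item to another cluster is a sequential move. -/
theorem isSequentialMove_single {X : Type*} [Fintype X] [DecidableEq X] {k : ℕ}
    (C : KClustering X k) (x : X) (j : Fin k) (h : C x ≠ j) :
    IsSequentialMove C (Function.update C x j) := by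
  refine ⟨0, ![C x, j], ![x], ?_, ?_⟩
  · intro a b hab
    fin_cases a <;> fin_cases b <;> simp_all
  · ext ⟨t, u, y⟩
    simp only [CDG, cluster, Set.mem_ofPred_eq, Finset.mem_filter, Finset.mem_univ, true_and,
      Set.mem_range, Arc.mk.injEq]
    constructor
    · rintro ⟨h1, h2, h3⟩
      by_cases hy : y = x
      · subst hy
        exact ⟨0, by simpa using h2, by simpa using h3, by simp⟩
      · rw [Function.update_of_ne hy] at h3
        exact absurd (h2.symm.trans h3) h1
    · rintro ⟨s, h1, h2, h3⟩
      have hs : s = 0 := Fin.fin_one_eq_zero s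
      subst hs
      simp at h1 h2 h3
      subst h1 h2 h3
      exact ⟨h, rfl, by simp⟩

/-- Any clustering can be transformed into any other one. -/
theorem exists_transformsIn {X : Type*} [Fintype X] {k : ℕ} (C C' : KClustering X k) :
    ∃ m, TransformsIn C C' m := by
  classical
  induction hn : (Finset.univ.filter fun x => C x ≠ C' x).card generalizing C with
  | zero =>
    refine ⟨0, fun _ => C, rfl, ?_, fun s hs => absurd hs (Nat.not_lt_zero s)⟩
    funext x
    by_contra hx
    have hmem : x ∈ Finset.univ.filter fun x => C x ≠ C' x := by simpa using hx
    rw [Finset.card_eq_zero] at hn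
    simp [hn] at hmem
  | succ n ih =>
    obtain ⟨x, hx⟩ : (Finset.univ.filter fun x => C x ≠ C' x).Nonempty := by
      rw [← Finset.card_pos]; omega
    have hx' : C x ≠ C' x := by simpa using hx
    have hset : (Finset.univ.filter fun y => Function.update C x (C' x) y ≠ C' y) =
        (Finset.univ.filter fun y => C y ≠ C' y).erase x := by
      ext y
      by_cases hy : y = x
      · subst hy; simp
      · simp [hy]
    obtain ⟨m, D, h0, hm, hstep⟩ := ih (Function.update C x (C' x)) (by
      rw [hset, Finset.card_erase_of_mem hx, hn]; rfl)
    refine ⟨m + 1, fun s => if s = 0 then C else D (s - 1), by simp, by simpa using hm, ?_⟩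
    rintro (_ | s) hs
    · right
      simpa [h0] using isSequentialMove_single C x (C' x) hx'
    · simpa using hstep s (by omega)

/-- The minimum in the definition of the transformation distance is attained. -/
theorem transformsIn_transformationDistance {X : Type*} [Fintype X] {k : ℕ}
    (C C' : KClustering X k) : TransformsIn C C' (transformationDistance C C') :=
  Nat.sInf_mem (exists_transformsIn C C')

namespace ClusteringTransformation

open Finset

/-! Read every misplaced item x as an arc from C x to C' x, and let T be the items not yet moved. On
T, `shared` is the shared degree and `surplus` the total excess of outdegree over indegree. At the
start the surplus Δ is half the sum of the δ_i.

Put L = η_{i₂}. A source–sink path is one move and lowers the surplus (`exists_step_surplus`), so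
max(Δ − L, 0) moves bring it down to L. Then η_{i₁} − L single moves bring the shared degree of i₁
down to L (`exists_step_shared`). Finally, L rounds of at most two moves each lower the common bound
on all shared degrees and on the surplus by one per round (`exists_step_layer`). No step raises any
of these quantities, and the total is at most η_{i₁} + max(L, Δ).

To find a round with bound M, redirect the arcs at each vertex beyond its shared degree to one extra
vertex, whose degree becomes the surplus. The result is Eulerian with all degrees at most M, so
Hall's theorem yields vertex-disjoint cycles through all vertices of degree M (`exists_layer`).
Undoing the redirection leaves disjoint cycles and at most one source–sink path
(`exists_layer_decomposition`).

Two moves realize such a layer for the reason that a product of disjoint cyclic permutations is a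
product of two cycles: the first move runs through all the cycles at once, and the second repairs
one item per cycle (`exists_merge`). The path is attached by letting one item make a stopover at an
endpoint of the merged path (`transformsIn_two`). -/

/-- The number of items of `T` that `f` sends to `v`. -/
def deg {X V : Type*} [DecidableEq V] (f : X → V) (T : Finset X) (v : V) : ℕ :=
  #{x ∈ T | f x = v}

/-- Viewing each item `x` as an arc from `f x` to `g x`, the list is a walk from `a` to `b`. -/
def IsWalk {X V : Type*} (f g : X → V) : V → List X → V → Prop
  | a, [], b => a = b
  | a, x :: l, b => f x = a ∧ IsWalk f g (g x) l b

/-! ### Walks as lists of arcs -/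

section Walks

variable {X V : Type*} {f g f' g' : X → V} {a b c : V} {x : X} {l l' : List X}

theorem IsWalk.append (h : IsWalk f g a l b) (h' : IsWalk f g b l' c) :
    IsWalk f g a (l ++ l') c := by
  induction l generalizing a with
  | nil => obtain rfl := h; exact h'
  | cons x l ih => exact ⟨h.1, ih h.2⟩

theorem IsWalk.exists_of_append (h : IsWalk f g a (l ++ l') b) :
    ∃ c, IsWalk f g a l c ∧ IsWalk f g c l' b := by
  induction l generalizing a with
  | nil => exact ⟨a, rfl, h⟩
  | cons x l ih =>
    obtain ⟨c, h1, h2⟩ := ih h.2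
    exact ⟨c, ⟨h.1, h1⟩, h2⟩

theorem IsWalk.congr (h : IsWalk f g a l b) (hf : ∀ x ∈ l, f' x = f x) (hg : ∀ x ∈ l, g' x = g x) :
    IsWalk f' g' a l b := by
  induction l generalizing a with
  | nil => exact h
  | cons x l ih =>
    refine ⟨(hf x (by simp)).trans h.1, ?_⟩
    rw [hg x (by simp)]
    exact ih h.2 (fun y hy => hf y (by simp [hy])) (fun y hy => hg y (by simp [hy]))

end Walks

/-! ### Degrees, simple walks and cycles -/

section Degrees

variable {X V : Type*} [DecidableEq V] {f g : X → V} {a b : V} {T S : Finset X}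

theorem deg_insert [DecidableEq X] {x : X} (hx : x ∉ T) (v : V) :
    deg f (insert x T) v = deg f T v + if f x = v then 1 else 0 := by
  unfold deg
  rw [filter_insert]
  split_ifs <;> simp [hx]

theorem deg_sdiff_add [DecidableEq X] (h : S ⊆ T) (v : V) :
    deg f (T \ S) v + deg f S v = deg f T v := by
  unfold deg
  rw [← card_union_of_disjoint, ← filter_union, sdiff_union_of_subset h]
  exact disjoint_filter_filter sdiff_disjoint

theorem deg_mono (h : S ⊆ T) (v : V) : deg f S v ≤ deg f T v :=
  card_le_card (filter_subset_filter _ h)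

theorem deg_pos {v : V} : 0 < deg f T v ↔ ∃ x ∈ T, f x = v := by
  simp [deg, card_pos, Finset.Nonempty]

theorem deg_le_one {v : V} : deg f T v ≤ 1 ↔ ∀ x ∈ T, ∀ y ∈ T, f x = v → f y = v → x = y := by
  unfold deg
  rw [card_le_one]
  simp only [mem_filter]
  exact ⟨fun h x hx y hy h1 h2 => h x ⟨hx, h1⟩ y ⟨hy, h2⟩,
    fun h x hx y hy => h x hx.1 y hy.1 hx.2 hy.2⟩

theorem sum_deg (U : Finset V) : ∑ v ∈ U, deg f T v = #{x ∈ T | f x ∈ U} := by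
  unfold deg
  rw [card_eq_sum_card_fiberwise (f := f) (t := U) (fun x hx => by simpa using (mem_filter.1 hx).2)]
  refine sum_congr rfl fun v hv => ?_
  congr 1
  ext x
  simp only [mem_filter]
  constructor
  · rintro ⟨h1, rfl⟩; exact ⟨⟨h1, hv⟩, rfl⟩
  · rintro ⟨h1, h2⟩; exact ⟨h1.1, h2⟩

/-- The head of each arc is the tail of the next, so only the endpoints fail to cancel. Distinct
tails make the items distinct, so that nothing is lost in passing from the list to the finset. -/
theorem IsWalk.deg_add [DecidableEq X] {l : List X} (h : IsWalk f g a l b)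
    (hl : (l.map f).Nodup) (v : V) :
    deg f l.toFinset v + (if b = v then 1 else 0) =
      deg g l.toFinset v + (if a = v then 1 else 0) := by
  induction l generalizing a with
  | nil => obtain rfl := h; simp [deg]
  | cons x l ih =>
    have hx : x ∉ l.toFinset := by
      rw [List.map_cons, List.nodup_cons] at hl
      intro hx
      exact hl.1 (List.mem_map_of_mem (List.mem_toFinset.1 hx))
    have := ih h.2 (List.nodup_cons.1 hl).2
    rw [List.toFinset_cons, deg_insert hx, deg_insert hx, h.1]
    omega

theorem deg_toFinset_le_one [DecidableEq X] {l : List X} (hl : (l.map f).Nodup) (v : V) :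
    deg f l.toFinset v ≤ 1 := by
  rw [deg_le_one]
  intro x hx y hy h1 h2
  exact List.inj_on_of_nodup_map hl (List.mem_toFinset.1 hx) (List.mem_toFinset.1 hy)
    (h1.trans h2.symm)

/-- Reachability is witnessed by walks without repeated vertices. -/
theorem exists_simple_walk (h : Relation.ReflTransGen (fun u v => ∃ x ∈ T, f x = u ∧ g x = v) a b) :
    ∃ l : List X, (∀ x ∈ l, x ∈ T) ∧ IsWalk f g a l b ∧ (l.map f).Nodup ∧ b ∉ l.map f := by
  induction h using Relation.ReflTransGen.head_induction_on with
  | refl => exact ⟨[], by simp, rfl, by simp, by simp⟩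
  | @head a c hac hcb ih =>
    obtain ⟨x, hx, rfl, rfl⟩ := hac
    obtain ⟨l, hT, hw, hn, hb⟩ := ih
    by_cases hab : f x = b
    · exact ⟨[], by simp, hab, by simp, by simp⟩
    by_cases hal : f x ∈ l.map f
    · obtain ⟨y, hy, hyx⟩ := List.mem_map.1 hal
      obtain ⟨s, t, rfl⟩ := List.append_of_mem hy
      obtain ⟨d, h1, h2⟩ := hw.exists_of_append
      refine ⟨y :: t, fun z hz => hT z (by simp_all), ?_, ?_, ?_⟩
      · exact ⟨hyx, h2.2⟩
      · rw [List.map_append, List.nodup_append] at hn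
        exact hn.2.1
      · intro h
        exact hb (by rw [List.map_append]; exact List.mem_append_right _ h)
    · refine ⟨x :: l, ?_, ⟨rfl, hw⟩, ?_, ?_⟩
      · intro z hz
        rcases List.mem_cons.1 hz with rfl | hz
        exacts [hx, hT z hz]
      · exact List.nodup_cons.2 ⟨hal, hn⟩
      · rw [List.map_cons, List.mem_cons, not_or]
        exact ⟨fun h => hab h.symm, hb⟩

/-- From a vertex with surplus outdegree there is a simple walk to one with surplus indegree. -/
theorem exists_simple_walk_of_deg_lt [Fintype V] (ha : deg g T a < deg f T a) :
    ∃ b, deg f T b < deg g T b ∧ ∃ l : List X, (∀ x ∈ l, x ∈ T) ∧ IsWalk f g a l b ∧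
      (l.map f).Nodup ∧ b ∉ l.map f := by
  classical
  set R : V → V → Prop := fun u v => ∃ x ∈ T, f x = u ∧ g x = v
  set U : Finset V := {v | Relation.ReflTransGen R a v} with hU
  -- The reachable set is closed under arcs: every arc that leaves one of its vertices also ends
  -- inside it.
  have hle : ∑ v ∈ U, deg f T v ≤ ∑ v ∈ U, deg g T v := by
    rw [sum_deg, sum_deg]
    refine card_le_card fun x hx => ?_
    simp only [hU, mem_filter, mem_univ, true_and] at hx ⊢
    exact ⟨hx.1, hx.2.tail ⟨x, hx.1, rfl, rfl⟩⟩
  obtain ⟨b, hbU, hb⟩ : ∃ b ∈ U, deg f T b < deg g T b := by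
    by_contra! hcon
    have : ∑ v ∈ U, deg g T v < ∑ v ∈ U, deg f T v :=
      sum_lt_sum hcon ⟨a, by simp [hU, Relation.ReflTransGen.refl], ha⟩
    omega
  simp only [hU, mem_filter, mem_univ, true_and] at hbU
  exact ⟨b, hb, exists_simple_walk hbU⟩

/-- Every arc of a vertex-disjoint union of cycles closes up to a cycle, and the other arcs again
form a vertex-disjoint union of cycles. -/
theorem exists_cycle [DecidableEq X] [Fintype V] (hS : ∀ v, deg f S v = deg g S v)
    (hne : ∀ x ∈ S, f x ≠ g x) {e : X} (he : e ∈ S) :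
    ∃ l : List X, (∀ x ∈ l, x ∈ S) ∧ IsWalk f g (g e) l (f e) ∧ ((l ++ [e]).map f).Nodup ∧
      (∀ v, deg f (S \ (l ++ [e]).toFinset) v = deg g (S \ (l ++ [e]).toFinset) v) := by
  have h1 : ∀ v, deg f S v = deg f (S.erase e) v + if f e = v then 1 else 0 := fun v => by
    rw [← deg_insert (notMem_erase e S), insert_erase he]
  have h2 : ∀ v, deg g S v = deg g (S.erase e) v + if g e = v then 1 else 0 := fun v => by
    rw [← deg_insert (notMem_erase e S), insert_erase he]
  have hfg := hne e he
  -- Without `e`, the only surplus is at `g e` and the only deficit at `f e`, so the walk must close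
  -- the cycle.
  obtain ⟨b, hb, l, hl, hw, hn, hbl⟩ := exists_simple_walk_of_deg_lt (f := f) (g := g)
    (T := S.erase e) (a := g e) (by
      have := h1 (g e); have := h2 (g e); have := hS (g e)
      simp [hfg] at *; omega)
  have hbe : f e = b := by
    by_contra hcon
    have := h1 b; have := h2 b; have := hS b
    rw [if_neg hcon] at *
    omega
  subst hbe
  have hlS : ∀ x ∈ l, x ∈ S := fun x hx => mem_of_mem_erase (hl x hx)
  have hn' : ((l ++ [e]).map f).Nodup := by
    rw [List.map_append, List.nodup_append]
    refine ⟨hn, by simp, ?_⟩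
    rintro v hv w hw rfl
    simp only [List.map_cons, List.map_nil, List.mem_singleton] at hw
    exact hbl (hw ▸ hv)
  have hw' : IsWalk f g (g e) (l ++ [e]) (g e) := hw.append ⟨rfl, rfl⟩
  refine ⟨l, hlS, hw, hn', fun v => ?_⟩
  have hsub : (l ++ [e]).toFinset ⊆ S := fun x hx => by
    simp only [List.mem_toFinset, List.mem_append, List.mem_singleton] at hx
    rcases hx with hx | rfl
    exacts [hlS x hx, he]
  have := deg_sdiff_add (f := f) hsub v
  have := deg_sdiff_add (f := g) hsub v
  have := hw'.deg_add hn' v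
  have := hS v
  omega

end Degrees

/-! ### Layers of disjoint cycles and a path -/

section Layers

variable {X V : Type*} [DecidableEq V]

/-- In an Eulerian multigraph of maximum degree at most `M`, some vertex-disjoint union of cycles
covers all vertices of degree `M`. -/
theorem exists_layer [Fintype V] {t h : X → V} {T : Finset X} {M : ℕ} (hM : 0 < M)
    (hth : ∀ v, deg t T v = deg h T v) (hle : ∀ v, deg t T v ≤ M) :
    ∃ B ⊆ T, (∀ v, deg t B v = deg h B v) ∧ (∀ v, deg t B v ≤ 1) ∧
      ∀ v, deg t T v = M → deg t B v = 1 := by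
  classical
  rcases T.eq_empty_or_nonempty with rfl | ⟨x₀, hx₀⟩
  · exact ⟨∅, Subset.refl _, by simp [deg], by simp [deg], fun v hv => by
      simp [deg] at hv; omega⟩
  have : Nonempty X := ⟨x₀⟩
  -- A vertex of degree below M may be matched to itself, which means that it stays idle.
  set N : V → Finset V := fun v => {w | (∃ x ∈ T, t x = v ∧ h x = w) ∨ (w = v ∧ deg t T v < M)}
    with hN
  -- Pad each vertex with M − deg idle loops. The padded graph is M-regular, and double counting the
  -- arcs leaving U gives Hall's condition.
  have hall : ∀ U : Finset V, #U ≤ #(U.biUnion N) := by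
    intro U
    have h1 : ∑ v ∈ U, deg t T v ≤ ∑ w ∈ U.biUnion N, deg h T w := by
      rw [sum_deg, sum_deg]
      refine card_le_card fun x hx => ?_
      simp only [mem_filter, mem_biUnion] at hx ⊢
      exact ⟨hx.1, t x, hx.2, by simpa [hN] using Or.inl ⟨x, hx.1, rfl, rfl⟩⟩
    have h2 : ∑ v ∈ U, (M - deg t T v) ≤ ∑ w ∈ U.biUnion N, (M - deg t T w) := by
      refine sum_le_sum_of_ne_zero fun v hv hne => ?_
      simp only [mem_biUnion]
      exact ⟨v, hv, by simp only [hN, mem_filter, mem_univ, true_and]; right; omega⟩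
    have h3 : ∀ W : Finset V, ∑ v ∈ W, deg t T v + ∑ v ∈ W, (M - deg t T v) = #W * M := by
      intro W
      rw [← sum_add_distrib, ← smul_eq_mul, ← sum_const]
      refine sum_congr rfl fun v _ => ?_
      have := hle v
      omega
    have h4 := h3 U
    have h5 := h3 (U.biUnion N)
    have h6 : ∑ v ∈ U.biUnion N, deg t T v = ∑ v ∈ U.biUnion N, deg h T v :=
      sum_congr rfl fun v _ => hth v
    rw [← h6] at h1
    exact Nat.le_of_mul_le_mul_right (by omega : #U * M ≤ #(U.biUnion N) * M) hM
  obtain ⟨p, hp, hpN⟩ := (all_card_le_biUnion_card_iff_exists_injective N).1 hall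
  have hps : Function.Surjective p := Finite.injective_iff_surjective.1 hp
  -- The non-idle vertices: these are permuted by `p` along genuine arcs, and they include all
  -- vertices of degree M.
  set act : Finset V := {v | ¬ (p v = v ∧ deg t T v < M)} with hact
  have hex : ∀ v, ∃ x, v ∈ act → x ∈ T ∧ t x = v ∧ h x = p v := by
    intro v
    by_cases hv : v ∈ act
    · have h1 := hpN v
      simp only [hN, hact, mem_filter, mem_univ, true_and] at h1 hv
      obtain ⟨x, hx⟩ := h1.resolve_right hv
      exact ⟨x, fun _ => hx⟩
    · exact ⟨x₀, fun h => absurd h hv⟩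
  choose x hx using hex
  have htpos : ∀ v, 0 < deg t (act.image x) v ↔ v ∈ act := by
    intro v
    rw [deg_pos]
    constructor
    · rintro ⟨y, hy, rfl⟩
      obtain ⟨u, hu, rfl⟩ := mem_image.1 hy
      rwa [(hx u hu).2.1]
    · exact fun hv => ⟨x v, mem_image_of_mem _ hv, (hx v hv).2.1⟩
  have hpact : ∀ u, p u ∈ act ↔ u ∈ act := by
    intro u
    have hiff : p (p u) = p u ↔ p u = u := hp.eq_iff
    simp only [hact, mem_filter, mem_univ, true_and, not_iff_not, hiff]
    constructor
    · rintro ⟨h1, h2⟩; exact ⟨h1, by rwa [h1] at h2⟩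
    · rintro ⟨h1, h2⟩; exact ⟨h1, by rwa [h1]⟩
  have hhpos : ∀ v, 0 < deg h (act.image x) v ↔ v ∈ act := by
    intro v
    rw [deg_pos]
    constructor
    · rintro ⟨y, hy, rfl⟩
      obtain ⟨u, hu, rfl⟩ := mem_image.1 hy
      rw [(hx u hu).2.2]
      exact (hpact u).2 hu
    · intro hv
      obtain ⟨u, rfl⟩ := hps v
      have hu := (hpact u).1 hv
      exact ⟨x u, mem_image_of_mem _ hu, (hx u hu).2.2⟩
  have ht1 : ∀ v, deg t (act.image x) v ≤ 1 := by
    intro v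
    rw [deg_le_one]
    simp only [mem_image]
    rintro _ ⟨u, hu, rfl⟩ _ ⟨w, hw, rfl⟩ h1 h2
    rw [(hx u hu).2.1] at h1
    rw [(hx w hw).2.1] at h2
    rw [h1, h2]
  have hh1 : ∀ v, deg h (act.image x) v ≤ 1 := by
    intro v
    rw [deg_le_one]
    simp only [mem_image]
    rintro _ ⟨u, hu, rfl⟩ _ ⟨w, hw, rfl⟩ h1 h2
    rw [(hx u hu).2.2] at h1
    rw [(hx w hw).2.2] at h2
    rw [hp (h1.trans h2.symm)]
  refine ⟨act.image x, ?_, fun v => ?_, ht1, fun v hv => ?_⟩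
  · intro y hy
    obtain ⟨u, hu, rfl⟩ := mem_image.1 hy
    exact (hx u hu).1
  · have := ht1 v; have := hh1 v; have := htpos v; have := hhpos v
    by_cases hv : v ∈ act <;> simp only [hv, iff_true, iff_false] at * <;> omega
  · have := ht1 v
    have h2 : v ∈ act := by
      simp only [hact, mem_filter, mem_univ, true_and]
      omega
    have := (htpos v).2 h2
    omega

/-- Redirect all but `m v` of the arcs at `v` to an additional vertex. -/
theorem exists_redirect [DecidableEq X] [Fintype V] (f : X → V) (T : Finset X) (m : V → ℕ)
    (hm : ∀ v, m v ≤ deg f T v) :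
    ∃ t : X → Option V, (∀ x, t x = none ∨ t x = some (f x)) ∧
      (∀ v, deg t T (some v) = m v) ∧
      (∀ x ∈ T, t x = none → m (f x) < deg f T (f x)) ∧ deg t T none + ∑ v, m v = #T := by
  have hex : ∀ v, ∃ K ⊆ {x ∈ T | f x = v}, #K = m v := fun v => exists_subset_card_eq (hm v)
  choose K hK hKm using hex
  have hdeg : ∀ v, deg (fun x => if x ∈ K (f x) then some (f x) else none) T (some v) = m v := by
    intro v
    rw [← hKm v, deg]
    congr 1
    ext x
    simp only [mem_filter]
    constructor
    · rintro ⟨h1, h2⟩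
      split_ifs at h2 with h3
      obtain rfl := Option.some.inj h2
      exact h3
    · intro hx
      obtain ⟨h1, rfl⟩ := mem_filter.1 (hK v hx)
      exact ⟨h1, by simp [hx]⟩
  refine ⟨fun x => if x ∈ K (f x) then some (f x) else none, ?_, hdeg, ?_, ?_⟩
  · intro x
    by_cases h : x ∈ K (f x) <;> simp [h]
  · intro x hx hn
    rw [← hKm]
    refine card_lt_card ⟨hK _, fun hss => ?_⟩
    have : x ∈ K (f x) := hss (mem_filter.2 ⟨hx, rfl⟩)
    simp [this] at hn
  · have := sum_deg (f := fun x => if x ∈ K (f x) then some (f x) else none) (T := T)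
      (univ : Finset (Option V))
    rw [Fintype.sum_option] at this
    simp only [hdeg] at this
    simpa using this

theorem deg_some_eq {f : X → V} {t : X → Option V} {T : Finset X}
    (h : ∀ x ∈ T, t x = some (f x)) (v : V) : deg t T (some v) = deg f T v := by
  unfold deg
  congr 1
  refine filter_congr fun x hx => ?_
  rw [h x hx, Option.some_inj]

/-- Exactly one arc of B was redirected, so undoing the redirection changes the degree of a single
vertex. -/
theorem exists_deg_eq_add [DecidableEq X] {f : X → V} {t : X → Option V} {B : Finset X}
    (ht : ∀ x, t x = none ∨ t x = some (f x)) (h : deg t B none = 1) :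
    ∃ x ∈ B, t x = none ∧
      ∀ v, deg f B v = deg t B (some v) + if f x = v then 1 else 0 := by
  obtain ⟨x, hx, hxt⟩ := deg_pos.1 (by omega : 0 < deg t B none)
  refine ⟨x, hx, hxt, fun v => ?_⟩
  have hs : ∀ y ∈ B.erase x, t y = some (f y) := by
    intro y hy
    refine (ht y).resolve_left fun hn => ?_
    exact (ne_of_mem_erase hy) (deg_le_one.1 h.le _ (mem_of_mem_erase hy) _ hx hn hxt)
  have h1 := deg_insert (f := f) (notMem_erase x B) v
  have h2 := deg_insert (f := t) (notMem_erase x B) (some v)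
  rw [insert_erase hx] at h1 h2
  rw [h1, h2, deg_some_eq hs, hxt]
  simp

/-- The total surplus outdegree. -/
def surplus [Fintype V] (f g : X → V) (T : Finset X) : ℕ :=
  ∑ v, (deg f T v - deg g T v)

/-- If all shared degrees and the total surplus are at most `M`, then there are a vertex-disjoint
union of cycles and a simple path, possibly empty, from a source to a sink, with interior disjoint
from the cycles, that together meet all vertices of shared degree `M`. -/
theorem exists_layer_decomposition [Fintype V] [Nonempty V] [DecidableEq X] {f g : X → V}
    {T : Finset X} {M : ℕ} (hM : 0 < M) (hη : ∀ v, min (deg f T v) (deg g T v) ≤ M)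
    (hΔ : surplus f g T ≤ M) :
    ∃ S ⊆ T, ∃ (a b : V) (P : List X), (∀ x ∈ P, x ∈ T ∧ x ∉ S) ∧
      (∀ v, deg f S v = deg g S v) ∧ (∀ v, deg f S v ≤ 1) ∧
      IsWalk f g a P b ∧ (P.map f).Nodup ∧ b ∉ P.map f ∧
      (P ≠ [] → deg g T a < deg f T a ∧ deg f T b < deg g T b) ∧
      (∀ x ∈ P.tail, ∀ y ∈ S, f x ≠ f y) ∧
      (∀ v, min (deg f T v) (deg g T v) = M → (∃ x ∈ S, f x = v) ∨ ∃ x ∈ P.tail, f x = v) ∧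
      (surplus f g T = M → P ≠ []) := by
  obtain ⟨t, ht, htm, htn, htΔ⟩ := exists_redirect f T (fun v => min (deg f T v) (deg g T v))
    (fun v => min_le_left _ _)
  obtain ⟨h, hh, hhm, hhn, hhΔ⟩ := exists_redirect g T (fun v => min (deg f T v) (deg g T v))
    (fun v => min_le_right _ _)
  have hs : deg t T none = surplus f g T := by
    have h1 := sum_deg (f := f) (T := T) (univ : Finset V)
    have h2 : surplus f g T + ∑ v, min (deg f T v) (deg g T v) = ∑ v, deg f T v := by
      rw [surplus, ← sum_add_distrib]
      exact sum_congr rfl fun v _ => by omega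
    simp only [mem_univ, filter_true] at h1
    omega
  obtain ⟨B, hBT, hBe, hB1, hBM⟩ := exists_layer (t := t) (h := h) (T := T) hM
    (by rintro (_ | v)
        · omega
        · rw [htm, hhm])
    (by rintro (_ | v)
        · omega
        · rw [htm]; exact hη v)
  rcases Nat.eq_zero_or_pos (deg t B none) with h0 | h0
  · have htB : ∀ x ∈ B, t x = some (f x) := fun x hx => (ht x).resolve_left fun hn => by
      have := deg_pos.2 ⟨x, hx, hn⟩
      omega
    have hhB : ∀ x ∈ B, h x = some (g x) := fun x hx => (hh x).resolve_left fun hn => by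
      have := deg_pos.2 ⟨x, hx, hn⟩
      have := hBe none
      omega
    obtain ⟨a⟩ := ‹Nonempty V›
    refine ⟨B, hBT, a, a, [], by simp, fun v => ?_, fun v => ?_, rfl, by simp, by simp, by simp,
      by simp, fun v hv => Or.inl ?_, fun hs' => ?_⟩
    · rw [← deg_some_eq htB, ← deg_some_eq hhB, hBe]
    · rw [← deg_some_eq htB]; exact hB1 _
    · rw [← deg_pos, ← deg_some_eq htB, hBM _ ((htm v).trans hv)]
      exact one_pos
    · have := hBM none (hs.trans hs')
      omega
  · have hn1 : deg t B none = 1 := le_antisymm (hB1 _) h0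
    obtain ⟨x, hx, hxt, hf⟩ := exists_deg_eq_add ht hn1
    obtain ⟨z, hz, hzh, hg⟩ := exists_deg_eq_add hh ((hBe none).symm.trans hn1)
    have hxs := htn x (hBT hx) hxt
    have hzs := hhn z (hBT hz) hzh
    -- Out-arcs are redirected only at sources and in-arcs only at sinks.
    have hab : f x ≠ g z := by
      intro h
      rw [h] at hxs
      omega
    -- With the original endpoints, B has surplus one at `f x`, deficit one at `g z`, and is
    -- balanced elsewhere. The endpoints may also lie on a remaining cycle, but interior vertices
    -- cannot.
    obtain ⟨b, hb, P, hPB, hw, hn, hbP⟩ := exists_simple_walk_of_deg_lt (f := f) (g := g) (T := B)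
      (a := f x) (by
        rw [hf, hg, hBe, if_pos rfl, if_neg (Ne.symm hab)]; omega)
    obtain rfl : g z = b := by
      by_contra hcon
      rw [hf, hg, hBe, if_neg hcon] at hb
      omega
    have hPB' : P.toFinset ⊆ B := fun y hy => hPB y (List.mem_toFinset.1 hy)
    obtain ⟨p, P, rfl⟩ : ∃ p Q, P = p :: Q := by
      cases P with
      | nil => exact absurd hw hab
      | cons p Q => exact ⟨p, Q, rfl⟩
    have hfP := deg_sdiff_add (f := f) hPB'
    have hgP := deg_sdiff_add (f := g) hPB'
    have hadd := hw.deg_add hn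
    have hP1 := deg_toFinset_le_one hn
    have hPpos : ∀ y ∈ p :: P, 0 < deg f (p :: P).toFinset (f y) := fun y hy =>
      deg_pos.2 ⟨y, List.mem_toFinset.2 hy, rfl⟩
    have hpx : f p = f x := hw.1
    refine ⟨B \ (p :: P).toFinset, sdiff_subset.trans hBT, f x, g z, p :: P, ?_, fun v => ?_,
      fun v => ?_, hw, hn, hbP, fun _ => ⟨by omega, by omega⟩, ?_, fun v hv => ?_, by simp⟩
    · intro y hy
      exact ⟨hBT (hPB y hy), fun h => (mem_sdiff.1 h).2 (List.mem_toFinset.2 hy)⟩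
    · have := hfP v; have := hgP v; have := hadd v; have := hf v; have := hg v
      have := hBe (some v)
      omega
    · have := hfP v; have := hf v; have := hB1 (some v)
      by_cases hv : f x = v
      · have := hPpos p (by simp)
        rw [hpx, hv] at this
        rw [if_pos hv] at *
        omega
      · rw [if_neg hv] at *
        omega
    · intro y hy y' hy' hyy
      have hy0 : f x ≠ f y := by
        rw [← hpx]
        intro h
        exact (List.nodup_cons.1 hn).1 (h ▸ List.mem_map_of_mem hy)
      have := hfP (f y); have := hf (f y); have := hB1 (some (f y))
      have := hPpos y (List.mem_cons_of_mem _ hy)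
      have := deg_pos.2 ⟨y', hy', hyy.symm⟩
      rw [if_neg hy0] at *
      omega
    · have h1 := hBM _ ((htm v).trans hv)
      have h2 := hf v
      have h3 := hfP v
      have h4 := hP1 v
      rcases Nat.eq_zero_or_pos (deg f (B \ (p :: P).toFinset) v) with h5 | h5
      · right
        by_cases hv : f x = v
        · rw [if_pos hv] at h2
          omega
        · rw [if_neg hv] at h2
          obtain ⟨y, hy, rfl⟩ := deg_pos.1 (by omega : 0 < deg f (p :: P).toFinset v)
          rcases List.mem_cons.1 (List.mem_toFinset.1 hy) with rfl | hy
          · exact absurd hpx.symm hv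
          · exact ⟨y, hy, rfl⟩
      · exact Or.inl (deg_pos.1 h5)

end Layers

/-! ### Vertex sequence of a walk -/

section WalkLemmas

variable {X V : Type*}

theorem IsWalk.getElem_succ {f g : X → V} {a b : V} {l : List X}
    (h : IsWalk f g a l b) (i : ℕ) (hi : i < l.length) :
    (l.map f ++ [b])[i + 1]'(by simp; omega) = g l[i] := by
  induction l generalizing a i with
  | nil => simp at hi
  | cons x l ih =>
    cases i with
    | zero =>
      cases l with
      | nil => exact h.2.symm
      | cons y l => exact h.2.1
    | succ i => simpa using ih h.2 i (by simpa using hi)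

end WalkLemmas

/-! ### Walks as sequential and cyclical moves -/

section Moves

variable {X : Type*} [Fintype X] {k : ℕ} {C D E : KClustering X k}

theorem transformsIn_refl (C : KClustering X k) : TransformsIn C C 0 :=
  ⟨fun _ => C, rfl, rfl, fun _ hs => absurd hs (Nat.not_lt_zero _)⟩

theorem transformsIn_trans {m n : ℕ} (h : TransformsIn C D m) (h' : TransformsIn D E n) :
    TransformsIn C E (m + n) := by
  obtain ⟨F, h0, hm, hF⟩ := h
  obtain ⟨F', h0', hn, hF'⟩ := h'
  refine ⟨fun s => if s < m then F s else F' (s - m), ?_, ?_, fun s hs => ?_⟩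
  · by_cases hm0 : 0 < m
    · simp [hm0, h0]
    · obtain rfl : m = 0 := by omega
      simp [h0', ← h0, ← hm]
  · simp [hn]
  · by_cases h1 : s + 1 < m
    · simpa [h1, (by omega : s < m)] using hF s (by omega)
    · by_cases h2 : s < m
      · obtain rfl : s + 1 = m := by omega
        have := hF s h2
        rw [hm, ← h0'] at this
        simpa using this
      · have := hF' (s - m) (by omega)
        simpa [h1, h2, (by omega : s + 1 - m = s - m + 1)] using this

theorem transformsIn_one (h : IsCyclicalMove C D ∨ IsSequentialMove C D) : TransformsIn C D 1 := by
  refine ⟨fun s => if s = 0 then C else D, by simp, by simp, fun s hs => ?_⟩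
  obtain rfl : s = 0 := by omega
  simpa using h

theorem mem_CDG {C D : KClustering X k} {α : Arc X k} :
    α ∈ CDG C D ↔ α.tail ≠ α.head ∧ C α.label = α.tail ∧ D α.label = α.head := by
  simp [CDG, cluster]

/-- Moving each item of a simple path to the position of the next one is a sequential move. -/
theorem transformsIn_one_of_path {l : List X} {a b : Fin k} (hl : l ≠ []) (hw : IsWalk D E a l b)
    (hn : (l.map D).Nodup) (hb : b ∉ l.map D) (hout : ∀ x, x ∉ l → E x = D x) :
    TransformsIn D E 1 := by
  refine transformsIn_one (Or.inr ?_)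
  obtain ⟨m, hm⟩ : ∃ m, l.length = m + 1 :=
    Nat.exists_eq_succ_of_ne_zero fun h => hl (List.length_eq_zero_iff.1 h)
  have hn' : (l.map D ++ [b]).Nodup := by
    rw [List.nodup_append]
    refine ⟨hn, by simp, ?_⟩
    rintro v hv w hw rfl
    exact hb ((List.mem_singleton.1 hw) ▸ hv)
  have hD : ∀ (i : ℕ) (hi : i < l.length),
      (l.map D ++ [b])[i]'(by simp; omega) = D l[i] := fun i hi => by
    rw [List.getElem_append_left (by simpa using hi), List.getElem_map]
  refine ⟨m, fun s => (l.map D ++ [b])[s.val]'(by simp; omega), fun s => l[s.val], ?_, ?_⟩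
  · intro s t hst
    exact Fin.ext ((hn'.getElem_inj_iff).1 hst)
  · ext ⟨t, u, y⟩
    simp only [mem_CDG, Set.mem_range, Arc.mk.injEq, Fin.val_castSucc, Fin.val_succ]
    constructor
    · rintro ⟨h1, rfl, rfl⟩
      have hy : y ∈ l := by
        by_contra hy
        exact h1 (hout y hy).symm
      obtain ⟨i, hi, rfl⟩ := List.getElem_of_mem hy
      exact ⟨⟨i, by omega⟩, hD i hi, hw.getElem_succ i hi, rfl⟩
    · rintro ⟨s, rfl, rfl, rfl⟩
      have hs : s.val < l.length := by omega
      refine ⟨?_, (hD _ hs).symm, (hw.getElem_succ _ hs).symm⟩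
      rw [Ne, hn'.getElem_inj_iff]
      omega

/-- Moving each item of a simple cycle to the position of the next one is a cyclical move. -/
theorem transformsIn_one_of_cycle {l : List X} {a : Fin k} (hl : 2 ≤ l.length)
    (hw : IsWalk D E a l a) (hn : (l.map D).Nodup) (hout : ∀ x, x ∉ l → E x = D x) :
    TransformsIn D E 1 := by
  refine transformsIn_one (Or.inl ?_)
  obtain ⟨m, hm⟩ : ∃ m, l.length = m + 2 := ⟨l.length - 2, by omega⟩
  have h0 : D l[0] = a := by
    cases l with
    | nil => simp at hl
    | cons x l => exact hw.1
  have hE : ∀ s : Fin (m + 2), D (l[(s + 1).val]'(by rw [hm]; exact (s + 1).isLt)) =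
      E (l[s.val]'(by omega)) := by
    intro s
    have h1 := hw.getElem_succ s.val (by omega)
    rw [← h1]
    have h2 := Fin.val_add_one s
    -- At the last index the successor wraps around to 0, where the walk started from `a`.
    by_cases hs : s = Fin.last (m + 1)
    · rw [if_pos hs] at h2
      simp only [h2, h0]
      subst hs
      rw [List.getElem_append_right (by simp [hm])]
      simp
    · rw [if_neg hs] at h2
      have : s.val ≠ m + 1 := fun h => hs (Fin.ext h)
      rw [List.getElem_append_left (by simp; omega), List.getElem_map]
      simp only [h2]
  refine ⟨m, fun s => D (l[s.val]'(by omega)), fun s => l[s.val], ?_, ?_⟩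
  · intro s t hst
    have : (l.map D)[s.val]'(by simp; omega) = (l.map D)[t.val]'(by simp; omega) := by
      simpa using hst
    exact Fin.ext ((hn.getElem_inj_iff).1 this)
  · ext ⟨t, u, y⟩
    simp only [mem_CDG, Set.mem_range, Arc.mk.injEq]
    constructor
    · rintro ⟨h1, rfl, rfl⟩
      have hy : y ∈ l := by
        by_contra hy
        exact h1 (hout y hy).symm
      obtain ⟨i, hi, rfl⟩ := List.getElem_of_mem hy
      exact ⟨⟨i, by omega⟩, rfl, hE ⟨i, by omega⟩, rfl⟩
    · rintro ⟨s, rfl, rfl, rfl⟩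
      refine ⟨?_, rfl, (hE s).symm⟩
      intro h
      have h1 : (l.map D)[s.val]'(by simp; omega) =
          (l.map D)[(s + 1).val]'(by rw [List.length_map, hm]; exact (s + 1).isLt) := by
        simpa using h
      rw [hn.getElem_inj_iff] at h1
      rw [Fin.val_add_one] at h1
      split_ifs at h1 with h3
      · rw [h3, Fin.val_last] at h1
        omega
      · omega

end Moves

/-! ### Merging disjoint cycles -/

section Merge

variable {X V : Type*} [DecidableEq V] [DecidableEq X] {f g : X → V}

theorem deg_le_one_sdiff {S R : Finset X} (h : ∀ v, deg f S v ≤ 1) (v : V) :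
    deg f (S \ R) v ≤ 1 :=
  (deg_mono sdiff_subset v).trans (h v)

/-- Disjoint cycles can be merged: moving the items of `l` along a simple path to positions `h`
leaves the items of `e :: r` to be moved along a simple path to complete all the cycles. -/
theorem exists_merge [Fintype V] {S : Finset X} (hS : ∀ v, deg f S v = deg g S v)
    (hS1 : ∀ v, deg f S v ≤ 1) (hne : ∀ x ∈ S, f x ≠ g x) {e : X} (he : e ∈ S) :
    ∃ (l r : List X) (h : X → V) (v : V), IsWalk f h v l (f e) ∧ h e = f e ∧
      IsWalk h g (g e) r v ∧ ((l ++ [e]).map f).Nodup ∧ (∀ x, x ∈ S ↔ x ∈ l ++ [e]) ∧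
      ((e :: r).map h).Nodup ∧ v ∉ (e :: r).map h ∧
      (∀ x ∈ e :: r, x ∈ S ∧ ∃ y ∈ S, f y = h x) ∧ (∀ x ∈ S, x ∉ e :: r → h x = g x) ∧
      ∃ y ∈ S, f y = v := by
  induction hc : #S using Nat.strong_induction_on generalizing S e with
  | _ n ih =>
  obtain ⟨l, hl, hw, hn, hS'⟩ := exists_cycle hS hne he
  have hfg := hne e he
  have hel : e ∉ l := by
    intro h
    rw [List.map_append, List.nodup_append] at hn
    exact hn.2.2 _ (List.mem_map_of_mem h) (f e) (by simp) rfl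
  have hinj : ∀ x ∈ S, ∀ y ∈ S, f x = f y → x = y := fun x hx y hy hxy =>
    deg_le_one.1 (hS1 (f y)) x hx y hy hxy rfl
  obtain ⟨y₀, hy₀, hy₀e⟩ : ∃ y ∈ l, f y = g e := by
    cases l with
    | nil => exact absurd hw.symm hfg
    | cons y l => exact ⟨y, by simp, hw.1⟩
  rcases (S \ (l ++ [e]).toFinset).eq_empty_or_nonempty with hemp | ⟨e', he'⟩
  · have hSl : ∀ x, x ∈ S ↔ x ∈ l ++ [e] := by
      intro x
      constructor
      · intro hx
        by_contra hcon
        have : x ∈ S \ (l ++ [e]).toFinset :=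
          mem_sdiff.2 ⟨hx, fun h => hcon (List.mem_toFinset.1 h)⟩
        rw [hemp] at this
        exact absurd this (notMem_empty _)
      · intro hx
        rcases List.mem_append.1 hx with hx | hx
        · exact hl x hx
        · rw [List.mem_singleton.1 hx]; exact he
    refine ⟨l, [], Function.update g e (f e), g e, ?_, by simp, rfl, hn, hSl, by simp, ?_, ?_, ?_,
      y₀, hl y₀ hy₀, hy₀e⟩
    · refine hw.congr (fun _ _ => rfl) fun x hx => ?_
      rw [Function.update_of_ne]
      rintro rfl
      exact hel hx
    · simpa using Ne.symm hfg
    · intro x hx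
      obtain rfl := List.mem_singleton.1 hx
      exact ⟨he, x, he, by simp⟩
    · intro x hx hxe
      rw [Function.update_of_ne (by simpa using hxe)]
  · have hlt : #(S \ (l ++ [e]).toFinset) < n := by
      rw [← hc]
      refine card_lt_card ⟨sdiff_subset, fun h => ?_⟩
      exact (mem_sdiff.1 (h he)).2 (by simp)
    obtain ⟨l', r, h, v, hw1, hhe, hw2, hn1, hS2, hn2, hv, hr, hh, y₁, hy₁, hy₁v⟩ :=
      ih _ hlt hS' (deg_le_one_sdiff hS1) (fun x hx => hne x (mem_sdiff.1 hx).1) he' rfl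
    set S' := S \ (l ++ [e]).toFinset with hS'def
    have hS'S : ∀ x ∈ S', x ∈ S ∧ x ∉ l ∧ x ≠ e := fun x hx => by
      have := mem_sdiff.1 hx
      simp at this
      tauto
    have hfS' : ∀ x ∈ S', ∀ y, y ∈ S → f x = f y → y ∈ S' := fun x hx y hy hxy =>
      hinj x (hS'S x hx).1 y hy hxy ▸ hx
    have hSS' : ∀ x ∈ S, x ∈ S' ∨ x ∈ l ∨ x = e := fun x hx => by
      by_contra! hcon
      exact hcon.1 (mem_sdiff.2 ⟨hx, by simp [hcon.2.1, hcon.2.2]⟩)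
    -- The representative `e'` of the cycles already merged is diverted to the start `g e` of the
    -- new cycle, and `e` now stays put. The second path gains `e` at its front, and its arc leads
    -- to `g e`, where `e'` waits.
    set G : X → V := fun x => if x ∈ l then g x else if x = e then f e else
      if x = e' then g e else h x with hG
    have hGl : ∀ x ∈ l, G x = g x := fun x hx => by simp [hG, hx]
    have hGe : G e = f e := by simp [hG, hel]
    have hGe' : G e' = g e := by simp [hG, hS'S e' he']
    have hGh : ∀ x ∈ S', x ≠ e' → G x = h x := fun x hx hxe => by simp [hG, hS'S x hx, hxe]
    have hl'e' : e' ∉ l' := by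
      intro h
      rw [List.map_append, List.nodup_append] at hn1
      exact hn1.2.2 _ (List.mem_map_of_mem h) (f e') (by simp) rfl
    have hre' : e' ∉ r := fun h =>
      (List.nodup_cons.1 hn2).1 (List.mem_map_of_mem h)
    have hGl' : ∀ x ∈ l', G x = h x := fun x hx =>
      hGh x ((hS2 x).2 (by simp [hx])) fun h => hl'e' (h ▸ hx)
    have hGr : ∀ x ∈ r, G x = h x := fun x hx =>
      hGh x (hr x (by simp [hx])).1 fun h => hre' (h ▸ hx)
    have hrG : ∀ x ∈ r, ∃ y ∈ S', f y = G x := fun x hx => by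
      rw [hGr x hx]; exact (hr x (by simp [hx])).2
    have hGrn : (r.map G).Nodup := by
      rw [List.map_congr_left hGr]
      exact (List.nodup_cons.1 hn2).2
    have hey : ∀ y ∈ S', f y ≠ f e := fun y hy hye => (hS'S e (hfS' y hy e he hye)).2.2 rfl
    have hgy : ∀ y ∈ S', f y ≠ g e := fun y hy hye =>
      (hS'S y₀ (hfS' y hy y₀ (hl y₀ hy₀) (hye.trans hy₀e.symm))).2.1 hy₀
    refine ⟨l' ++ e' :: l, e' :: r, G, v, ?_, hGe, ⟨hGe', ?_⟩, ?_, ?_, ?_, ?_, ?_, ?_,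
      y₁, (hS'S y₁ hy₁).1, hy₁v⟩
    · refine (hw1.congr (fun _ _ => rfl) hGl').append ⟨rfl, ?_⟩
      rw [hGe']
      exact hw.congr (fun _ _ => rfl) hGl
    · exact hw2.congr hGr fun _ _ => rfl
    · have : l' ++ e' :: l ++ [e] = (l' ++ [e']) ++ (l ++ [e]) := by simp
      rw [this, List.map_append, List.nodup_append]
      refine ⟨hn1, hn, ?_⟩
      rintro u hu w hw rfl
      obtain ⟨x, hx, rfl⟩ := List.mem_map.1 hu
      obtain ⟨y, hy, hxy⟩ := List.mem_map.1 hw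
      have hxS := (hS2 x).2 hx
      have hyS : y ∈ S := by
        rcases List.mem_append.1 hy with hy | hy
        · exact hl y hy
        · rw [List.mem_singleton.1 hy]; exact he
      have := hS'S y (hfS' x hxS y hyS hxy.symm)
      simp at hy
      tauto
    · intro x
      have h1 := hS2 x
      have h2 := hSS' x
      have h3 := hS'S x
      have h4 := hl x
      simp only [List.mem_append, List.mem_cons, List.not_mem_nil, or_false] at h1 ⊢
      constructor
      · intro hx
        have := h2 hx
        tauto
      · rintro ((hx | rfl | hx) | rfl)
        · exact (h3 (h1.2 (Or.inl hx))).1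
        · exact (h3 (h1.2 (Or.inr rfl))).1
        · exact h4 hx
        · exact he
    · rw [List.map_cons, List.map_cons, List.nodup_cons, List.nodup_cons, hGe, hGe']
      refine ⟨?_, ?_, hGrn⟩
      · rw [List.mem_cons, not_or]
        refine ⟨hfg, fun h => ?_⟩
        obtain ⟨x, hx, hxe⟩ := List.mem_map.1 h
        obtain ⟨y, hy, hyx⟩ := hrG x hx
        exact hey y hy (hyx.trans hxe)
      · intro h
        obtain ⟨x, hx, hxe⟩ := List.mem_map.1 h
        obtain ⟨y, hy, hyx⟩ := hrG x hx
        exact hgy y hy (hyx.trans hxe)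
    · rw [List.map_cons, List.map_cons, hGe, hGe', List.map_congr_left hGr, ← hy₁v]
      simp only [List.map_cons, List.mem_cons, not_or] at hv ⊢
      exact ⟨hey y₁ hy₁, hgy y₁ hy₁, by rw [hy₁v]; exact hv.2⟩
    · intro x hx
      rcases List.mem_cons.1 hx with rfl | hx
      · exact ⟨he, x, he, hGe.symm⟩
      rcases List.mem_cons.1 hx with rfl | hx
      · exact ⟨(hS'S x he').1, y₀, hl y₀ hy₀, by rw [hGe', hy₀e]⟩
      · obtain ⟨y, hy, hyx⟩ := hrG x hx
        exact ⟨(hS'S x (hr x (by simp [hx])).1).1, y, (hS'S y hy).1, hyx⟩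
    · intro x hx hxr
      simp only [List.mem_cons, not_or] at hxr
      rcases hSS' x hx with hx | hx | hx
      · rw [hGh x hx hxr.2.1]
        exact hh x hx (by simp [hxr.2.1, hxr.2.2])
      · exact hGl x hx
      · exact absurd hx hxr.1

end Merge

/-! ### Realizing a layer in two moves -/

section TwoMoves

variable {X : Type*} [Fintype X] {k : ℕ} {D E : KClustering X k} {S : Finset X}
  {a b : Fin k}

/-- Two moves suffice for nonempty disjoint cycles `S` together with a path `K ++ [x]` in front of
them in the first move and a path `x :: Q` behind them in the second move. -/
theorem transformsIn_two [DecidableEq X] (hS : ∀ v, deg D S v = deg E S v)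
    (hS1 : ∀ v, deg D S v ≤ 1)
    (hne : ∀ x ∈ S, D x ≠ E x) (hS0 : S.Nonempty) {K Q : List X} {x : X}
    (hK : IsWalk D E a K (D x)) (hKn : ((K ++ [x]).map D).Nodup)
    (hKS : ∀ y ∈ K ++ [x], ∀ z ∈ S, D y ≠ D z)
    (hQ : IsWalk D E (E x) Q b) (hQn : (Q.map D).Nodup) (hbQ : b ∉ Q.map D)
    (hQS : ∀ y ∈ Q, ∀ z ∈ S, D y ≠ D z) (hxQ : x ∉ Q) (hKQ : ∀ y ∈ K, y ∉ Q)
    (hout : ∀ y, y ∉ S → y ∉ K → y ≠ x → y ∉ Q → E y = D y) : TransformsIn D E 2 := by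
  -- The second move will start at `D e`. If its end `b` lies on a cycle, this choice makes that
  -- move cyclical.
  obtain ⟨e, he, hbe⟩ : ∃ e ∈ S, (∃ y ∈ S, D y = b) → D e = b := by
    by_cases h : ∃ y ∈ S, D y = b
    · obtain ⟨y, hy, hyb⟩ := h
      exact ⟨y, hy, fun _ => hyb⟩
    · obtain ⟨y, hy⟩ := hS0
      exact ⟨y, hy, fun h' => absurd h' h⟩
  obtain ⟨l, r, G, v, hw1, hGe, hw2, hn1, hSl, hn2, hv, hr, hG, y₁, hy₁, hy₁v⟩ :=
    exists_merge hS hS1 hne he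
  have hxK : x ∉ K := by
    intro h
    rw [List.map_append, List.nodup_append] at hKn
    exact hKn.2.2 _ (List.mem_map_of_mem h) (D x) (by simp) rfl
  have hKS' : ∀ y ∈ K, y ∉ S := fun y hy hyS => hKS y (by simp [hy]) y hyS rfl
  have hxS : x ∉ S := fun hyS => hKS x (by simp) x hyS rfl
  have hQS' : ∀ y ∈ Q, y ∉ S := fun y hy hyS => hQS y hy y hyS rfl
  have hlS : ∀ y ∈ l, y ∈ S := fun y hy => (hSl y).2 (by simp [hy])
  have hrS : ∀ y ∈ e :: r, y ∈ S := fun y hy => (hr y hy).1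
  -- In the intermediate clustering `x` stops over at `v`, which is both the start of the first
  -- merged path and the end of the second.
  set F : X → Fin k := fun y => if y = x then v else if y ∈ K then E y else
    if y ∈ S then G y else D y with hF
  have hFx : F x = v := by simp [hF]
  have hFK : ∀ y ∈ K, F y = E y := fun y hy => by
    have : y ≠ x := fun h => hxK (h ▸ hy)
    simp [hF, this, hy]
  have hFS : ∀ y ∈ S, F y = G y := fun y hy => by
    have h1 : y ≠ x := fun h => hxS (h ▸ hy)
    have h2 : y ∉ K := fun h => hKS' y h hy
    simp [hF, h1, h2, hy]
  have hFD : ∀ y, y ≠ x → y ∉ K → y ∉ S → F y = D y := fun y h1 h2 h3 => by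
    simp [hF, h1, h2, h3]
  have hFQ : ∀ y ∈ Q, F y = D y := fun y hy =>
    hFD y (fun h => hxQ (h ▸ hy)) (fun h => hKQ y h hy) (hQS' y hy)
  have hDF : TransformsIn D F 1 := by
    have hn : ((K ++ [x] ++ (l ++ [e])).map D).Nodup := by
      rw [List.map_append, List.nodup_append]
      refine ⟨hKn, hn1, ?_⟩
      rintro u hu w hw rfl
      obtain ⟨y, hy, rfl⟩ := List.mem_map.1 hu
      obtain ⟨z, hz, hzy⟩ := List.mem_map.1 hw
      exact hKS y hy z ((hSl z).2 hz) hzy.symm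
    have hn' : (((K ++ x :: l) ++ [e]).map D).Nodup := by simpa using hn
    rw [List.map_append, List.nodup_append] at hn'
    refine transformsIn_one_of_path (l := K ++ x :: l) (a := a) (b := D e) (by simp)
      ((hK.congr (fun _ _ => rfl) hFK).append ⟨rfl, ?_⟩) hn'.1
      (fun h => hn'.2.2 _ h (D e) (by simp) rfl) fun y hy => ?_
    · rw [hFx]
      exact hw1.congr (fun _ _ => rfl) fun y hy => hFS y (hlS y hy)
    · simp only [List.mem_append, List.mem_cons, not_or] at hy
      by_cases hyS : y ∈ S
      · have := (hSl y).1 hyS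
        simp only [List.mem_append, hy.2.2, List.mem_singleton, false_or] at this
        rw [hFS y hyS, this, hGe]
      · exact hFD y hy.2.1 hy.1 hyS
  have hFE : TransformsIn F E 1 := by
    have hw : IsWalk F E (D e) (e :: r ++ x :: Q) b := by
      refine IsWalk.append (b := v) ⟨(hFS e he).trans hGe, ?_⟩ ⟨hFx, ?_⟩
      · exact hw2.congr (fun y hy => hFS y (hrS y (by simp [hy]))) fun _ _ => rfl
      · exact hQ.congr hFQ fun _ _ => rfl
    have hmap : (e :: r).map F = (e :: r).map G := List.map_congr_left fun y hy => hFS y (hrS y hy)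
    have hmapQ : Q.map F = Q.map D := List.map_congr_left hFQ
    have hvQ : v ∉ Q.map D := fun h => by
      obtain ⟨y, hy, hyv⟩ := List.mem_map.1 h
      exact hQS y hy y₁ hy₁ (hyv.trans hy₁v.symm)
    have hn : ((e :: r ++ x :: Q).map F).Nodup := by
      rw [List.map_append, List.map_cons (l := Q), hmap, hmapQ, hFx, List.nodup_append,
        List.nodup_cons]
      refine ⟨hn2, ⟨hvQ, hQn⟩, ?_⟩
      rintro u hu w hw rfl
      obtain ⟨y, hy, hyu⟩ := List.mem_map.1 hu
      rcases List.mem_cons.1 hw with rfl | hw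
      · exact hv hu
      · obtain ⟨z, hz, hzu⟩ := List.mem_map.1 hw
        obtain ⟨s, hs, hsy⟩ := (hr y hy).2
        exact hQS z hz s hs (hzu.trans (hyu.symm.trans hsy.symm))
    have hout' : ∀ y, y ∉ e :: r ++ x :: Q → E y = F y := by
      intro y hy
      simp only [List.cons_append, List.mem_cons, List.mem_append, not_or] at hy
      by_cases hyK : y ∈ K
      · exact (hFK y hyK).symm
      by_cases hyS : y ∈ S
      · rw [hFS y hyS]
        exact (hG y hyS (by simp [hy.1, hy.2.1])).symm
      · rw [hFD y hy.2.2.1 hyK hyS]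
        exact hout y hyS hyK hy.2.2.1 hy.2.2.2
    by_cases hb : ∃ y ∈ S, D y = b
    · rw [← hbe hb] at hw
      exact transformsIn_one_of_cycle (by simp; omega) hw hn hout'
    · refine transformsIn_one_of_path (by simp) hw hn ?_ hout'
      rw [List.map_append, List.map_cons (l := Q), hmap, hmapQ, hFx, List.mem_append,
        List.mem_cons, not_or, not_or]
      refine ⟨fun h => ?_, fun h => hb ⟨y₁, hy₁, hy₁v.trans h.symm⟩, hbQ⟩
      obtain ⟨y, hy, hyb⟩ := List.mem_map.1 h
      obtain ⟨s, hs, hsy⟩ := (hr y hy).2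
      exact hb ⟨s, hs, hsy.trans hyb⟩
  exact transformsIn_trans hDF hFE

/-- A simple path, possibly empty, takes at most one move. -/
theorem exists_transformsIn_path {P : List X} (hw : IsWalk D E a P b) (hn : (P.map D).Nodup)
    (hb : b ∉ P.map D) (hout : ∀ x, x ∉ P → E x = D x) : ∃ n ≤ 1, TransformsIn D E n := by
  by_cases hP : P = []
  · subst hP
    obtain rfl : E = D := funext fun x => hout x (by simp)
    exact ⟨0, by omega, transformsIn_refl _⟩
  · exact ⟨1, le_rfl, transformsIn_one_of_path hP hw hn hb hout⟩

/-- The cycle through `e`, traversed from `E e` back to `E e`, followed by P is a single walk. The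
first move handles this cycle up to `e`, the second handles P, and `e` makes the stopover that
merges in the other cycles. If there are none, the cycle and the path are separate moves. -/
theorem exists_transformsIn_of_path_from_cycle [DecidableEq X]
    (hS : ∀ v, deg D S v = deg E S v) (hS1 : ∀ v, deg D S v ≤ 1) (hne : ∀ x ∈ S, D x ≠ E x)
    {P : List X} {e : X} (he : e ∈ S)
    (hP : IsWalk D E (E e) P b) (hPn : (P.map D).Nodup) (hbP : b ∉ P.map D)
    (hPS : ∀ x ∈ P, x ∉ S) (hint : ∀ x ∈ P.tail, ∀ y ∈ S, D x ≠ D y)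
    (hout : ∀ x, x ∉ S → x ∉ P → E x = D x) : ∃ n ≤ 2, TransformsIn D E n := by
  obtain ⟨l, hl, hw, hn, hS'⟩ := exists_cycle hS hne he
  have hle : ∀ y ∈ l ++ [e], y ∈ S := fun y hy => by
    rcases List.mem_append.1 hy with hy | hy
    · exact hl y hy
    · rw [List.mem_singleton.1 hy]; exact he
  have hfg := hne e he
  obtain ⟨y₀, hy₀, hy₀e⟩ : ∃ y ∈ l, D y = E e := by
    cases l with
    | nil => exact absurd hw.symm hfg
    | cons y l => exact ⟨y, by simp, hw.1⟩
  rcases (S \ (l ++ [e]).toFinset).eq_empty_or_nonempty with hemp | hS0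
  · have hSl : ∀ x, x ∈ S → x ∈ l ++ [e] := fun x hx => by
      rw [sdiff_eq_empty_iff_subset] at hemp
      exact List.mem_toFinset.1 (hemp hx)
    set F : X → Fin k := fun y => if y ∈ S then E y else D y with hF
    have hFS : ∀ y ∈ S, F y = E y := fun y hy => by simp [hF, hy]
    have hFD : ∀ y, y ∉ S → F y = D y := fun y hy => by simp [hF, hy]
    have h1 : TransformsIn D F 1 := by
      refine transformsIn_one_of_cycle (l := l ++ [e]) (a := E e) ?_ ?_ hn fun y hy => ?_
      · have := List.length_pos_of_mem hy₀
        simp; omega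
      · exact IsWalk.congr (hw.append ⟨rfl, rfl⟩) (fun _ _ => rfl) fun y hy => hFS y (hle y hy)
      · exact hFD y fun h => hy (hSl y h)
    have hPF : P.map F = P.map D := List.map_congr_left fun y hy => hFD y (hPS y hy)
    obtain ⟨n, hn1, h2⟩ := exists_transformsIn_path (D := F) (E := E) (P := P) (a := E e) (b := b)
      (hP.congr (fun y hy => hFD y (hPS y hy)) fun _ _ => rfl) (by rwa [hPF]) (by rwa [hPF])
      (fun y hy => by
        by_cases hyS : y ∈ S
        · exact (hFS y hyS).symm
        · rw [hFD y hyS]; exact hout y hyS hy)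
    exact ⟨1 + n, by omega, transformsIn_trans h1 h2⟩
  · refine ⟨2, le_rfl, transformsIn_two hS' (deg_le_one_sdiff hS1)
      (fun x hx => hne x (mem_sdiff.1 hx).1) hS0 hw hn ?_ hP hPn hbP ?_ (fun h => hPS e h he)
      (fun y hy h => hPS y h (hl y hy)) fun y h1 h2 h3 h4 => hout y (fun h => h1 ?_) h4⟩
    · intro y hy z hz hyz
      have := deg_le_one.1 (hS1 (D z)) y (hle y hy) z (mem_sdiff.1 hz).1 hyz rfl
      exact (mem_sdiff.1 hz).2 (by rw [List.mem_toFinset, ← this]; exact hy)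
    · intro y hy z hz hyz
      have hzS := mem_sdiff.1 hz
      cases P with
      | nil => simp at hy
      | cons p P =>
        rcases List.mem_cons.1 hy with rfl | hy
        · have h1 : D y₀ = D z := by rw [hy₀e, ← hyz]; exact hP.1.symm
          have := deg_le_one.1 (hS1 (D z)) y₀ (hl y₀ hy₀) z hzS.1 h1 rfl
          exact hzS.2 (by rw [List.mem_toFinset, ← this]; simp [hy₀])
        · exact hint y hy z hzS.1 hyz
    · exact mem_sdiff.2 ⟨h, by simp [h2, h3]⟩

/-- A simple path, possibly empty, and disjoint cycles that avoid its interior take at most two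
moves. -/
theorem exists_transformsIn_layer [DecidableEq X] (hS : ∀ v, deg D S v = deg E S v)
    (hS1 : ∀ v, deg D S v ≤ 1) (hne : ∀ x ∈ S, D x ≠ E x) {P : List X}
    (hP : IsWalk D E a P b) (hPn : (P.map D).Nodup) (hbP : b ∉ P.map D)
    (hPS : ∀ x ∈ P, x ∉ S) (hint : ∀ x ∈ P.tail, ∀ y ∈ S, D x ≠ D y)
    (hout : ∀ x, x ∉ S → x ∉ P → E x = D x) : ∃ n ≤ 2, TransformsIn D E n := by
  rcases S.eq_empty_or_nonempty with rfl | ⟨e, he⟩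
  · obtain ⟨n, hn, h⟩ := exists_transformsIn_path hP hPn hbP fun x hx => hout x (by simp) hx
    exact ⟨n, by omega, h⟩
  cases P with
  | nil =>
    -- The empty path may be placed at any vertex of any cycle.
    exact exists_transformsIn_of_path_from_cycle hS hS1 hne he (P := []) (b := E e) rfl (by simp)
      (by simp) (by simp) (by simp) hout
  | cons p P =>
    by_cases ha : ∃ e ∈ S, E e = a
    · obtain ⟨e, he, rfl⟩ := ha
      exact exists_transformsIn_of_path_from_cycle hS hS1 hne he hP hPn hbP hPS hint hout
    -- No cycle passes through `a`, so the first item of the path can itself make the stopover.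
    · rw [List.map_cons, List.nodup_cons] at hPn
      refine ⟨2, le_rfl, transformsIn_two (a := a) hS hS1 hne ⟨e, he⟩ (K := []) (Q := P) (x := p)
        hP.1.symm (by simp) ?_ hP.2 hPn.2 (fun h => hbP (by simp_all)) hint
        (fun h => hPn.1 (List.mem_map_of_mem h)) (by simp)
        fun y h1 _ h3 h4 => hout y h1 (by simp [h3, h4])⟩
      intro y hy z hz hyz
      simp only [List.nil_append, List.mem_singleton] at hy
      subst hy
      refine ha (deg_pos.1 ?_)
      rw [← hS, deg_pos]
      exact ⟨z, hz, hyz.symm.trans hP.1⟩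

end TwoMoves

/-! ### Effect of removing arcs on surplus and shared degrees -/

section Removal

variable {X V : Type*} [DecidableEq V] {f g f' : X → V} {S T : Finset X} {a b : V} {P : List X}

theorem deg_congr (h : ∀ x ∈ T, f' x = f x) (v : V) : deg f' T v = deg f T v := by
  unfold deg
  congr 1
  exact filter_congr fun x hx => by rw [h x hx]

/-- The smaller one of the numbers of arcs leaving and entering `v`. -/
def shared (f g : X → V) (T : Finset X) (v : V) : ℕ :=
  min (deg f T v) (deg g T v)

theorem shared_mono (h : S ⊆ T) (v : V) : shared f g S v ≤ shared f g T v :=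
  min_le_min (deg_mono h v) (deg_mono h v)

variable [DecidableEq X]

theorem surplus_sdiff [Fintype V] (hST : S ⊆ T) (hS : ∀ v, deg f S v = deg g S v) :
    surplus f g (T \ S) = surplus f g T := by
  refine sum_congr rfl fun v _ => ?_
  have := deg_sdiff_add (f := f) hST v
  have := deg_sdiff_add (f := g) hST v
  have := hS v
  omega

theorem shared_sdiff_lt (hST : S ⊆ T) (hS : ∀ v, deg f S v = deg g S v) {x : X} (hx : x ∈ S) :
    shared f g (T \ S) (f x) < shared f g T (f x) := by
  have := deg_sdiff_add (f := f) hST (f x)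
  have := deg_sdiff_add (f := g) hST (f x)
  have := hS (f x)
  have := deg_pos (f := f).2 ⟨x, hx, rfl⟩
  unfold shared
  omega

/-- The excess at `a` drops by one, the sink `b` contributes zero before and after, and all other
vertices lose equally many arcs in both directions. -/
theorem surplus_sdiff_path_lt [Fintype V] (hP : P.toFinset ⊆ T) (hw : IsWalk f g a P b)
    (hn : (P.map f).Nodup) (ha : deg g T a < deg f T a) (hb : deg f T b < deg g T b) :
    surplus f g (T \ P.toFinset) < surplus f g T := by
  have hab : b ≠ a := by
    rintro rfl
    omega
  have key := fun v => (⟨deg_sdiff_add (f := f) hP v, deg_sdiff_add (f := g) hP v,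
    hw.deg_add hn v⟩ : _ ∧ _ ∧ _)
  refine sum_lt_sum (fun v _ => ?_) ⟨a, mem_univ _, ?_⟩
  · obtain ⟨h1, h2, h3⟩ := key v
    by_cases hv : b = v
    · subst hv
      rw [if_pos rfl, if_neg hab.symm] at h3
      omega
    · rw [if_neg hv] at h3
      split_ifs at h3 <;> omega
  · obtain ⟨h1, h2, h3⟩ := key a
    rw [if_pos rfl, if_neg hab] at h3
    omega

/-- Items of the tail of P start at interior vertices of the path, which lose one arc in each
direction. -/
theorem shared_sdiff_path_lt (hP : P.toFinset ⊆ T) (hw : IsWalk f g a P b)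
    (hn : (P.map f).Nodup) (hb : b ∉ P.map f) {x : X} (hx : x ∈ P.tail) :
    shared f g (T \ P.toFinset) (f x) < shared f g T (f x) := by
  have hxP : x ∈ P := List.mem_of_mem_tail hx
  have h1 := deg_sdiff_add (f := f) hP (f x)
  have h2 := deg_sdiff_add (f := g) hP (f x)
  have h3 := hw.deg_add hn (f x)
  have h4 := deg_pos (f := f).2 ⟨x, List.mem_toFinset.2 hxP, rfl⟩
  have hbx : b ≠ f x := fun h => hb (h ▸ List.mem_map_of_mem hxP)
  have hax : a ≠ f x := by
    cases P with
    | nil => simp at hx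
    | cons p P =>
      rw [← hw.1]
      exact fun h => (List.nodup_cons.1 hn).1 (h ▸ List.mem_map_of_mem hx)
  rw [if_neg hbx, if_neg hax] at h3
  unfold shared
  omega

end Removal

/-! ### The three phases of the transformation -/

section Steps

variable {X : Type*} [DecidableEq X] {k : ℕ}

/-- The clustering in which exactly the items of `T` are still at their position in `C`. -/
def mixed (C C' : KClustering X k) (T : Finset X) : KClustering X k :=
  fun x => if x ∈ T then C x else C' x

variable {C C' : KClustering X k} {T R : Finset X}

theorem mixed_of_mem {x : X} (hx : x ∈ T) : mixed C C' T x = C x := if_pos hx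

theorem mixed_of_notMem {x : X} (hx : x ∉ T) : mixed C C' T x = C' x := if_neg hx

theorem mixed_sdiff_of_mem {x : X} (hx : x ∈ R) : mixed C C' (T \ R) x = C' x :=
  if_neg fun h => (mem_sdiff.1 h).2 hx

theorem mixed_sdiff_of_notMem {x : X} (hx : x ∉ R) : mixed C C' (T \ R) x = mixed C C' T x := by
  simp [mixed, hx]

variable [Fintype X]

theorem transformsIn_mixed_path {a b : Fin k} {P : List X} (hP : P.toFinset ⊆ T) (hP0 : P ≠ [])
    (hw : IsWalk C C' a P b) (hn : (P.map C).Nodup) (hb : b ∉ P.map C) :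
    TransformsIn (mixed C C' T) (mixed C C' (T \ P.toFinset)) 1 := by
  have hC : ∀ x ∈ P, mixed C C' T x = C x := fun x hx => mixed_of_mem (hP (by simpa using hx))
  have hmap := List.map_congr_left hC
  exact transformsIn_one_of_path hP0
    (hw.congr hC fun x hx => mixed_sdiff_of_mem (by simpa using hx)) (by rwa [hmap])
    (by rwa [hmap]) fun x hx => mixed_sdiff_of_notMem (by simpa using hx)

theorem exists_step_surplus (hpos : 0 < surplus C C' T) :
    ∃ T' ⊆ T, TransformsIn (mixed C C' T) (mixed C C' T') 1 ∧
      surplus C C' T' < surplus C C' T := by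
  obtain ⟨a, ha⟩ : ∃ a, deg C' T a < deg C T a := by
    by_contra! h
    have : surplus C C' T = 0 := sum_eq_zero fun v _ => by have := h v; omega
    omega
  obtain ⟨b, hb, P, hPT, hw, hn, hbP⟩ := exists_simple_walk_of_deg_lt ha
  have hP : P.toFinset ⊆ T := fun x hx => hPT x (List.mem_toFinset.1 hx)
  refine ⟨T \ P.toFinset, sdiff_subset, transformsIn_mixed_path hP ?_ hw hn hbP,
    surplus_sdiff_path_lt hP hw hn ha hb⟩
  rintro rfl
  obtain rfl := hw
  omega

theorem exists_step_shared (hT : ∀ x ∈ T, C x ≠ C' x) {i : Fin k} (hpos : 0 < shared C C' T i)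
    (hi : ∀ j, shared C C' T j ≤ shared C C' T i) (hΔ : surplus C C' T ≤ shared C C' T i) :
    ∃ T' ⊆ T, TransformsIn (mixed C C' T) (mixed C C' T') 1 ∧
      surplus C C' T' ≤ surplus C C' T ∧ shared C C' T' i < shared C C' T i := by
  have : Nonempty (Fin k) := ⟨i⟩
  obtain ⟨S, hST, a, b, P, hPT, hS, hS1, hw, hn, hb, hab, -, hcov, -⟩ :=
    exists_layer_decomposition hpos hi hΔ
  have hP : P.toFinset ⊆ T := fun x hx => (hPT x (List.mem_toFinset.1 hx)).1
  -- Only the component of the layer that passes through `i` is carried out, hence a single move.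
  rcases hcov i rfl with ⟨e, he, rfl⟩ | ⟨x, hx, rfl⟩
  · obtain ⟨l, hl, hwl, hnl, -⟩ := exists_cycle hS (fun x hx => hT x (hST hx)) he
    have hlS : ∀ x ∈ l ++ [e], x ∈ S := fun x hx => by
      rcases List.mem_append.1 hx with hx | hx
      · exact hl x hx
      · rw [List.mem_singleton.1 hx]; exact he
    have hlT : (l ++ [e]).toFinset ⊆ T := fun x hx => hST (hlS x (List.mem_toFinset.1 hx))
    have hcyc : IsWalk C C' (C' e) (l ++ [e]) (C' e) := hwl.append ⟨rfl, rfl⟩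
    have hbal : ∀ v, deg C (l ++ [e]).toFinset v = deg C' (l ++ [e]).toFinset v := fun v => by
      have := hcyc.deg_add hnl v
      omega
    have hC : ∀ x ∈ l ++ [e], mixed C C' T x = C x := fun x hx =>
      mixed_of_mem (hlT (List.mem_toFinset.2 hx))
    have hmap := List.map_congr_left hC
    refine ⟨T \ (l ++ [e]).toFinset, sdiff_subset, ?_, (surplus_sdiff hlT hbal).le,
      shared_sdiff_lt hlT hbal (by simp)⟩
    refine transformsIn_one_of_cycle (a := C' e) ?_
      (hcyc.congr hC fun x hx => mixed_sdiff_of_mem (List.mem_toFinset.2 hx)) (by rwa [hmap])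
      fun x hx => mixed_sdiff_of_notMem (fun h => hx (List.mem_toFinset.1 h))
    cases l with
    | nil => exact absurd hwl.symm (hT e (hST he))
    | cons y l => simp
  · have hP0 : P ≠ [] := by
      rintro rfl
      simp at hx
    exact ⟨T \ P.toFinset, sdiff_subset, transformsIn_mixed_path hP hP0 hw hn hb,
      (surplus_sdiff_path_lt hP hw hn (hab hP0).1 (hab hP0).2).le,
      shared_sdiff_path_lt hP hw hn hb hx⟩

theorem exists_step_layer [NeZero k] (hT : ∀ x ∈ T, C x ≠ C' x) {M : ℕ}
    (hη : ∀ j, shared C C' T j ≤ M + 1) (hΔ : surplus C C' T ≤ M + 1) :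
    ∃ T' ⊆ T, (∃ n ≤ 2, TransformsIn (mixed C C' T) (mixed C C' T') n) ∧
      surplus C C' T' ≤ M ∧ ∀ j, shared C C' T' j ≤ M := by
  obtain ⟨S, hST, a, b, P, hPT, hS, hS1, hw, hn, hb, hab, hint, hcov, hcovΔ⟩ :=
    exists_layer_decomposition (Nat.succ_pos M) hη hΔ
  have hP : P.toFinset ⊆ T := fun x hx => (hPT x (List.mem_toFinset.1 hx)).1
  have hSP : S ⊆ T \ P.toFinset := fun x hx =>
    mem_sdiff.2 ⟨hST hx, fun h => (hPT x (List.mem_toFinset.1 h)).2 hx⟩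
  have hsub1 : T \ (S ∪ P.toFinset) ⊆ T \ P.toFinset := sdiff_subset_sdiff subset_rfl
    subset_union_right
  have hsub2 : T \ (S ∪ P.toFinset) ⊆ T \ S := sdiff_subset_sdiff subset_rfl
    subset_union_left
  have hCS : ∀ x ∈ S, mixed C C' T x = C x := fun x hx => mixed_of_mem (hST hx)
  have hCP : ∀ x ∈ P, mixed C C' T x = C x := fun x hx => mixed_of_mem (hPT x hx).1
  have hES : ∀ x ∈ S, mixed C C' (T \ (S ∪ P.toFinset)) x = C' x := fun x hx =>
    mixed_sdiff_of_mem (mem_union_left _ hx)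
  have hEP : ∀ x ∈ P, mixed C C' (T \ (S ∪ P.toFinset)) x = C' x := fun x hx =>
    mixed_sdiff_of_mem (mem_union_right _ (List.mem_toFinset.2 hx))
  have hmap := List.map_congr_left hCP
  refine ⟨T \ (S ∪ P.toFinset), sdiff_subset, ?_, ?_, fun j => ?_⟩
  · refine exists_transformsIn_layer (S := S) (P := P) (a := a) (b := b) (fun v => ?_) (fun v => ?_)
      (fun x hx => ?_) (hw.congr hCP hEP) (by rwa [hmap]) (by rwa [hmap]) (fun x hx => (hPT x hx).2)
      (fun x hx y hy => ?_) fun x h1 h2 => mixed_sdiff_of_notMem (by simp [h1, h2])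
    · rw [deg_congr hCS, deg_congr hES, hS]
    · rw [deg_congr hCS]; exact hS1 v
    · rw [hCS x hx, hES x hx]; exact hT x (hST hx)
    · rw [hCP x (List.mem_of_mem_tail hx), hCS y hy]; exact hint x hx y hy
  · have hTSP : T \ (S ∪ P.toFinset) = (T \ P.toFinset) \ S := by
      ext x
      simp only [mem_sdiff, mem_union]
      tauto
    rw [hTSP, surplus_sdiff hSP hS]
    -- A surplus equal to M + 1 forces a nonempty path, so an empty one means that the surplus was
    -- already small enough.
    by_cases hP0 : P = []
    · have : surplus C C' T ≠ M + 1 := fun h => hcovΔ h hP0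
      subst hP0
      rw [List.toFinset_nil, sdiff_empty]
      omega
    · have := surplus_sdiff_path_lt hP hw hn (hab hP0).1 (hab hP0).2
      omega
  · have h1 := hη j
    have h2 := shared_mono (f := C) (g := C') (sdiff_subset : T \ (S ∪ P.toFinset) ⊆ T) j
    rcases Nat.lt_or_ge (shared C C' T j) (M + 1) with h3 | h3
    · omega
    rcases hcov j (le_antisymm h1 h3) with ⟨x, hx, rfl⟩ | ⟨x, hx, rfl⟩
    · have := shared_sdiff_lt hST hS hx
      have := shared_mono (f := C) (g := C') hsub2 (C x)
      omega
    · have := shared_sdiff_path_lt hP hw hn hb hx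
      have := shared_mono (f := C) (g := C') hsub1 (C x)
      omega

theorem exists_transformsIn_of_le [NeZero k] (L : ℕ) (hT : ∀ x ∈ T, C x ≠ C' x)
    (hη : ∀ j, shared C C' T j ≤ L) (hΔ : surplus C C' T ≤ L) :
    ∃ n ≤ 2 * L, TransformsIn (mixed C C' T) C' n := by
  induction L generalizing T with
  | zero =>
    -- An outdegree is at most the shared degree plus the local excess, so all outdegrees vanish.
    have hT0 : T = ∅ := by
      by_contra hne
      obtain ⟨x, hx⟩ := nonempty_iff_ne_empty.2 hne
      have h1 := deg_pos (f := C).2 ⟨x, hx, rfl⟩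
      have h2 := hη (C x)
      have h3 : deg C T (C x) - deg C' T (C x) ≤ surplus C C' T :=
        single_le_sum (f := fun v => deg C T v - deg C' T v) (fun _ _ => Nat.zero_le _)
          (mem_univ (C x))
      unfold shared at h2
      omega
    subst hT0
    exact ⟨0, le_rfl, transformsIn_refl C'⟩
  | succ L ih =>
    obtain ⟨T', hT', ⟨n, hn, h1⟩, hΔ', hη'⟩ := exists_step_layer hT hη hΔ
    obtain ⟨m, hm, h2⟩ := ih (fun x hx => hT x (hT' hx)) hη' hΔ'
    exact ⟨n + m, by omega, transformsIn_trans h1 h2⟩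

theorem exists_transformsIn_of_shared_le [NeZero k] (L p : ℕ) (hT : ∀ x ∈ T, C x ≠ C' x)
    (i : Fin k) (hi : shared C C' T i ≤ L + p) (hη : ∀ j, j ≠ i → shared C C' T j ≤ L)
    (hΔ : surplus C C' T ≤ L) :
    ∃ n ≤ 2 * L + p, TransformsIn (mixed C C' T) C' n := by
  induction p generalizing T with
  | zero =>
    refine exists_transformsIn_of_le L hT (fun j => ?_) hΔ
    by_cases hj : j = i
    · exact hj ▸ hi
    · exact hη j hj
  | succ p ih =>
    rcases Nat.lt_or_ge (shared C C' T i) (L + (p + 1)) with h | h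
    · obtain ⟨n, hn, h1⟩ := ih hT (by omega) hη hΔ
      exact ⟨n, by omega, h1⟩
    · obtain ⟨T', hT', h1, hΔ', hi'⟩ := exists_step_shared hT (i := i) (by omega) (fun j => by
        by_cases hj : j = i
        · rw [hj]
        · have := hη j hj
          omega) (by omega)
      obtain ⟨m, hm, h2⟩ := ih (fun x hx => hT x (hT' hx)) (by omega)
        (fun j hj => (shared_mono hT' j).trans (hη j hj)) (by omega)
      exact ⟨1 + m, by omega, transformsIn_trans h1 h2⟩

theorem exists_transformsIn_of_surplus_le [NeZero k] (L p q : ℕ) (hT : ∀ x ∈ T, C x ≠ C' x)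
    (i : Fin k) (hi : shared C C' T i ≤ L + p) (hη : ∀ j, j ≠ i → shared C C' T j ≤ L)
    (hΔ : surplus C C' T ≤ L + q) :
    ∃ n ≤ 2 * L + p + q, TransformsIn (mixed C C' T) C' n := by
  induction q generalizing T with
  | zero => exact exists_transformsIn_of_shared_le L p hT i hi hη hΔ
  | succ q ih =>
    rcases Nat.eq_zero_or_pos (surplus C C' T) with h | h
    · obtain ⟨n, hn, h1⟩ := ih hT hi hη (by omega)
      exact ⟨n, by omega, h1⟩
    · obtain ⟨T', hT', h1, hΔ'⟩ := exists_step_surplus h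
      obtain ⟨m, hm, h2⟩ := ih (fun x hx => hT x (hT' hx)) ((shared_mono hT' i).trans hi)
        (fun j hj => (shared_mono hT' j).trans (hη j hj)) (by omega)
      exact ⟨1 + m, by omega, transformsIn_trans h1 h2⟩

end Steps

/-! ### Translation to the clustering-difference graph -/

section ClusteringDifferenceGraph

variable {X : Type*} [Fintype X] {k : ℕ} (C C' : KClustering X k)

theorem outDegree_CDG (i : Fin k) : outDegree (CDG C C') i = deg C {x | C x ≠ C' x} i := by
  have h : {α ∈ CDG C C' | α.tail = i} =
      (fun x => Arc.mk (C x) (C' x) x) ''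
        (({x ∈ {x | C x ≠ C' x} | C x = i} : Finset X) : Set X) := by
    ext ⟨t, u, y⟩
    simp only [Set.mem_ofPred_eq, mem_CDG, Set.mem_image, mem_coe, mem_filter, mem_univ, true_and,
      Arc.mk.injEq]
    constructor
    · rintro ⟨⟨h1, rfl, rfl⟩, h2⟩
      exact ⟨y, ⟨h1, h2⟩, rfl, rfl, rfl⟩
    · rintro ⟨x, ⟨h1, h2⟩, rfl, rfl, rfl⟩
      exact ⟨⟨h1, rfl, rfl⟩, h2⟩
  rw [outDegree, h, Set.ncard_image_of_injective _ fun x y h => congrArg Arc.label h,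
    Set.ncard_coe_finset, deg]

theorem inDegree_CDG (i : Fin k) : inDegree (CDG C C') i = deg C' {x | C x ≠ C' x} i := by
  have h : {α ∈ CDG C C' | α.head = i} =
      (fun x => Arc.mk (C x) (C' x) x) ''
        (({x ∈ {x | C x ≠ C' x} | C' x = i} : Finset X) : Set X) := by
    ext ⟨t, u, y⟩
    simp only [Set.mem_ofPred_eq, mem_CDG, Set.mem_image, mem_coe, mem_filter, mem_univ, true_and,
      Arc.mk.injEq]
    constructor
    · rintro ⟨⟨h1, rfl, rfl⟩, h2⟩
      exact ⟨y, ⟨h1, h2⟩, rfl, rfl, rfl⟩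
    · rintro ⟨x, ⟨h1, h2⟩, rfl, rfl, rfl⟩
      exact ⟨⟨h1, rfl, rfl⟩, h2⟩
  rw [inDegree, h, Set.ncard_image_of_injective _ fun x y h => congrArg Arc.label h,
    Set.ncard_coe_finset, deg]

theorem sharedDegree_CDG (i : Fin k) :
    sharedDegree (CDG C C') i = shared C C' {x | C x ≠ C' x} i := by
  rw [sharedDegree, inDegree_CDG, outDegree_CDG, shared, min_comm]

theorem sizeChange_eq (i : Fin k) : sizeChange C C' i =
    |(deg C {x | C x ≠ C' x} i : ℤ) - (deg C' {x | C x ≠ C' x} i : ℤ)| := by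
  classical
  have h1 := deg_sdiff_add (f := C) (subset_univ ({x | C x ≠ C' x} : Finset X)) i
  have h2 := deg_sdiff_add (f := C') (subset_univ ({x | C x ≠ C' x} : Finset X)) i
  have h3 := deg_congr (f := C') (f' := C) (T := univ \ ({x | C x ≠ C' x} : Finset X))
    (fun x hx => by simpa using hx) i
  have h4 : (cluster C i).card = deg C univ i := rfl
  have h5 : (cluster C' i).card = deg C' univ i := rfl
  rw [sizeChange, h4, h5, ← h1, ← h2, h3]
  push_cast
  congr 1
  ring

/-- In- and outdegrees have equal totals, so the signed differences d sum to zero. Adding them and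
using |d| + d = 2 max(d, 0) gives the claim. -/
theorem sum_sizeChange :
    ∑ i, sizeChange C C' i = 2 * (surplus C C' {x | C x ≠ C' x} : ℤ) := by
  have h1 := sum_deg (f := C) (T := ({x | C x ≠ C' x} : Finset X)) univ
  have h2 := sum_deg (f := C') (T := ({x | C x ≠ C' x} : Finset X)) univ
  simp only [mem_univ, filter_true] at h1 h2
  have h3 : (∑ i, ((deg C {x | C x ≠ C' x} i : ℤ) - (deg C' {x | C x ≠ C' x} i : ℤ))) = 0 := by
    rw [sum_sub_distrib, ← Nat.cast_sum, ← Nat.cast_sum, h1, h2, sub_self]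
  rw [← add_zero (∑ i, _), ← h3, ← sum_add_distrib, surplus, Nat.cast_sum, mul_sum]
  refine sum_congr rfl fun i _ => ?_
  rw [sizeChange_eq]
  rcases abs_cases ((deg C {x | C x ≠ C' x} i : ℤ) - (deg C' {x | C x ≠ C' x} i : ℤ)) with h | h <;>
    omega

end ClusteringDifferenceGraph

end ClusteringTransformation

theorem mainTheorem1 {X : Type*} [Fintype X] {k : ℕ} (C C' : KClustering X k) (i₁ i₂ : Fin k)
    (hi₁ : ∀ j, sharedDegree (CDG C C') j ≤ sharedDegree (CDG C C') i₁)
    (hne : i₂ ≠ i₁)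
    (hi₂ : ∀ j, j ≠ i₁ → sharedDegree (CDG C C') j ≤ sharedDegree (CDG C C') i₂) :
    (transformationDistance C C' : ℚ) ≤
      (sharedDegree (CDG C C') i₁ : ℚ) +
        max (sharedDegree (CDG C C') i₂ : ℚ) ((1 / 2 : ℚ) * ∑ i, (sizeChange C C' i : ℚ)) := by
  classical
  open ClusteringTransformation in
  have : NeZero k := ⟨fun h => (h ▸ i₁).elim0⟩
  have h12 := hi₁ i₂
  simp only [sharedDegree_CDG] at *
  set T : Finset X := {x | C x ≠ C' x} with hT
  have hmixed : mixed C C' T = C := by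
    funext x
    by_cases hx : x ∈ T
    · exact mixed_of_mem hx
    · rw [mixed_of_notMem hx]
      simpa [hT, eq_comm] using hx
  -- Here L = η_{i₂}, p = η_{i₁} − L and q = Δ − L. Truncation in q produces the maximum: 2L + p + q
  -- = η_{i₁} + max(L, Δ).
  obtain ⟨n, hn, h⟩ := exists_transformsIn_of_surplus_le (C := C) (C' := C') (T := T)
    (shared C C' T i₂) (shared C C' T i₁ - shared C C' T i₂)
    (surplus C C' T - shared C C' T i₂) (fun x hx => (Finset.mem_filter.1 hx).2) i₁
    (by omega) hi₂ (by omega)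
  rw [hmixed] at h
  have hle : transformationDistance C C' ≤
      shared C C' T i₁ + max (shared C C' T i₂) (surplus C C' T) :=
    (Nat.sInf_le h).trans (hn.trans (by omega))
  have hsum : (1 / 2 : ℚ) * ∑ i, (sizeChange C C' i : ℚ) = (surplus C C' T : ℚ) := by
    rw [← Int.cast_sum, sum_sizeChange]
    push_cast
    ring
  rw [hsum]
  exact_mod_cast hle
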